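/- Let $X$ be a real topological vector space whose topology is induced by a metric $d$ (a metric vector space; $d$ need not be translation invariant or complete), and let $C \subseteq X$ be a nonempty closed convex subset. Let $f : C \to C$ be a (not necessarily continuous) map such that: (a) $f$ is onto; (b$_1$) for every nonempty finite subset $\{x_1,\dots,x_n\} \subseteq C$ and every convex combination $u = \sum_{i=1}^n \alpha_i x_i$ with $\alpha_1,\dots,\alpha_n > 0$ and $\sum_{i=1}^n \alpha_i = 1$, $$\max\{d(f(x_j),u) - d(x_j,u) : j = 1,\dots,n\} \ge 0;$$ (c$_1$) there is $x^* \in C$ such that the set $\{y \in C : d(x^*,y) \le d(f(x^*),y)\}$ is compact. Then $f$ has a fixed point, i.e. there is $x \in C$ with $f(x) = x$. -/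

import Mathlib

/-!
For `x ∈ C` let `G x` be the set of `y ∈ C` with `dist x y ≤ dist (f x) y`. These sets are closed,
and hypothesis (b₁) says exactly that they satisfy the covering condition of Knaster, Kuratowski
and Mazurkiewicz: a convex combination with positive weights of points `x₁, …, xₙ` of `C` lies in
some `G xⱼ`. Hence finitely many of them always have a common point, and since one of them is
compact there is a point `y` in all of them. As `f` is onto, `y = f x` for some `x`, and `y ∈ G x`
reads `dist x y ≤ dist y y = 0`, so that `x = y = f x`.

The Knaster–Kuratowski–Mazurkiewicz lemma is derived from Scarf's combinatorial lemma
(`exists_isDominant_colorful`), which needs no triangulation of the simplex. In a finite set ranked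
in several ways, one for each index, call a set `T` dominant if no element lies above the minimum
of `T` in every ranking. A set with one element fewer than there are indices extends to a dominant
set in an even number of ways (`even_card_dominant_insert`), with a single exception at the
boundary, while a set that misses a color contains an even number of subsets of the kind counted
(`even_card_subsets_of_not_colorful`); double counting gives a dominant set with all the colors.

On the grid of integer vectors of coordinate sum `m`, dominant sets are small, with a diameter
bounded independently of `m` (`exists_grid_point_near_colors`). For `m → ∞` this yields a covering
theorem without boundary conditions: if closed sets `A i` cover the simplex, some `p` lies in `A i`
for every `i` in its support (`exists_mem_stdSimplex_forall_eq_zero_or_mem`). To find a common point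
of sets `G i` as in the Knaster–Kuratowski–Mazurkiewicz lemma, apply it to
`A i = {x | x i * ∑ j, infDist x (G j) ≤ infDist x (G i)}`: some `i` in the support of `p` has
`p ∈ G i`, hence `∑ j, infDist p (G j) = 0`.
-/

/-! ### Dominant sets and Scarf's parity argument -/

section Scarf

variable {I Z L : Type*} [LinearOrder L]

/-- A finite set `T` is dominant for a family `u` of rankings (one ranking of `Z` for each index)
when no element of `Z` lies strictly above the `u i`-minimum of `T` for every index `i`. The minima
are not mentioned explicitly, so that the empty set needs no separate treatment. -/
def IsDominant (u : I → Z → L) (T : Finset Z) : Prop :=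
  ∀ z, ∃ i, ∀ t ∈ T, u i z ≤ u i t

theorem IsDominant.mono {u : I → Z → L} {S T : Finset Z} (h : IsDominant u T) (hST : S ⊆ T) :
    IsDominant u S := fun z =>
  (h z).imp fun _ hi t ht => hi t (hST ht)

/-- Each element of a dominant set is the minimum of that set for some index of its own. -/
theorem IsDominant.exists_index {u : I → Z → L} (hu : ∀ i, Function.Injective (u i))
    {T : Finset Z} (h : IsDominant u T) :
    ∃ a : Z → I, Set.InjOn a T ∧ ∀ s, ∀ t ∈ T, u (a s) s ≤ u (a s) t := by
  choose a ha using h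
  refine ⟨a, fun s hs t ht hst => ?_, ha⟩
  refine hu (a s) (le_antisymm (ha s t ht) ?_)
  rw [hst]
  exact ha t s hs

/-- Pivoting: a set with one element fewer than there are indices has an even number of one-point
extensions to a dominant set (two if it is dominant itself, none otherwise). If `T` is dominant,
exactly two indices `i ≠ j` share their minimum over `T`, and the two extensions arise by
maximizing `u k`, for `k = i` or `k = j`, among the points above all the minima with index other
than `k`; the hypothesis `habove` says that there are such points. -/
theorem even_card_dominant_insert [Fintype I] [Fintype Z] [DecidableEq Z] {u : I → Z → L}
    (hu : ∀ i, Function.Injective (u i)) {T : Finset Z} (hcard : T.card + 1 = Fintype.card I)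
    (hT : T.Nonempty) (habove : ∀ k, ∃ z, ∀ l, l ≠ k → ∃ t ∈ T, u l t < u l z)
    [DecidablePred fun x => x ∉ T ∧ IsDominant u (insert x T)] :
    Even (Finset.univ.filter fun x => x ∉ T ∧ IsDominant u (insert x T)).card := by
  classical
  by_cases hdom : IsDominant u T
  swap
  · rw [Finset.filter_false_of_mem]
    · simp
    · exact fun x _ hx => hdom (hx.2.mono (Finset.subset_insert x T))
  choose m hmT hmin using fun i => T.exists_min_image (u i) hT
  have hsurj : ∀ s : Z, ∃ i, s ∈ T → m i = s := by
    intro s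
    obtain ⟨i, hi⟩ := hdom s
    exact ⟨i, fun hs => hu i (le_antisymm (hmin i s hs) (hi _ (hmT i)))⟩
  choose b hb using hsurj
  have hbinj : Set.InjOn b T := fun s hs t ht h => by rw [← hb s hs, h, hb t ht]
  obtain ⟨i, hi⟩ : ∃ i, (T.image b)ᶜ = {i} := by
    rw [← Finset.card_eq_one, Finset.card_compl, Finset.card_image_of_injOn hbinj]
    omega
  -- `i` is the one index that the section `b` of `m` misses; `j` is the one with the same minimum
  have hbm : ∀ l, l ≠ i → b (m l) = l := by
    intro l hl
    have : l ∈ T.image b := by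
      by_contra h
      have : l ∈ (T.image b)ᶜ := by simpa using h
      rw [hi] at this
      exact hl (by simpa using this)
    obtain ⟨s, hs, rfl⟩ := Finset.mem_image.1 this
    rw [hb s hs]
  obtain ⟨j, hj⟩ : ∃ j, j = b (m i) := ⟨_, rfl⟩
  have hmj : m j = m i := by rw [hj, hb _ (hmT i)]
  have hij : i ≠ j := by
    intro h
    have h1 : i ∈ (T.image b)ᶜ := by rw [hi]; simp
    rw [Finset.mem_compl] at h1
    exact h1 (Finset.mem_image.2 ⟨m i, hmT i, by rw [← hj, h]⟩)
  have hcoll : ∀ k l, l ≠ k → m l = m k → k = i ∨ k = j := by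
    intro k l hlk h
    by_cases hk : k = i
    · exact Or.inl hk
    · by_cases hl : l = i
      · right
        rw [← hbm k hk, ← h, hl, hj]
      · exact absurd (by rw [← hbm k hk, ← hbm l hl, h]) hlk
  have hmax : ∀ k, ∃ x, (∀ l, l ≠ k → u l (m l) < u l x) ∧
      ∀ z, (∀ l, l ≠ k → u l (m l) < u l z) → u k z ≤ u k x := by
    intro k
    obtain ⟨z, hz⟩ := habove k
    obtain ⟨x, hx, hx'⟩ := Finset.exists_max_image
      (Finset.univ.filter fun z => ∀ l, l ≠ k → u l (m l) < u l z) (u k) ⟨z, by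
        simp only [Finset.mem_filter, Finset.mem_univ, true_and]
        intro l hl
        obtain ⟨t, ht, htz⟩ := hz l hl
        exact (hmin l t ht).trans_lt htz⟩
    simp only [Finset.mem_filter, Finset.mem_univ, true_and] at hx hx'
    exact ⟨x, hx, hx'⟩
  choose x hx1 hx2 using hmax
  have hgood : ∀ k k', k' ≠ k → m k' = m k → x k ∉ T ∧ IsDominant u (insert (x k) T) := by
    intro k k' hk' hm
    refine ⟨fun hxT => ?_, ?_⟩
    · obtain ⟨l, hl, hml⟩ : ∃ l, l ≠ k ∧ m l = x k := by
        by_cases h : b (x k) = k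
        · exact ⟨k', hk', by rw [hm, ← h, hb _ hxT, h]⟩
        · exact ⟨_, h, hb _ hxT⟩
      have := hx1 k l hl
      rw [hml] at this
      exact lt_irrefl _ this
    · by_contra hnot
      simp only [IsDominant, not_forall, not_exists, not_le] at hnot
      obtain ⟨z, hz⟩ := hnot
      have hzk : u k z ≤ u k (x k) := by
        refine hx2 k z fun l hl => ?_
        obtain ⟨t, ht, htz⟩ := hz l
        rcases Finset.mem_insert.1 ht with rfl | ht
        · exact (hx1 k l hl).trans htz
        · exact (hmin l t ht).trans_lt htz
      obtain ⟨t, ht, htz⟩ := hz k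
      rcases Finset.mem_insert.1 ht with rfl | ht'
      · exact absurd htz hzk.not_gt
      · obtain ⟨l, hl⟩ := hdom (x k)
        by_cases hlk : l = k
        · subst hlk
          exact absurd (htz.trans_le hzk) (hl t ht').not_gt
        · exact absurd (hx1 k l hlk) (hl _ (hmT l)).not_gt
  have hxij : x i ≠ x j := by
    intro h
    obtain ⟨l, hl⟩ := hdom (x i)
    by_cases hli : l = i
    · have := hx1 j l (by rw [hli]; exact hij)
      rw [← h] at this
      exact absurd this (hl _ (hmT l)).not_gt
    · exact absurd (hx1 i l hli) (hl _ (hmT l)).not_gt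
  have hset : (Finset.univ.filter fun x => x ∉ T ∧ IsDominant u (insert x T)) = {x i, x j} := by
    ext y
    simp only [Finset.mem_filter, Finset.mem_univ, true_and, Finset.mem_insert,
      Finset.mem_singleton]
    constructor
    · rintro ⟨hyT, hy⟩
      obtain ⟨a, ha, hamin⟩ := hy.exists_index hu
      have himg : (insert y T).image a = Finset.univ := by
        rw [← Finset.card_eq_iff_eq_univ, Finset.card_image_of_injOn ha,
          Finset.card_insert_of_notMem hyT, hcard]
      have hma : ∀ l, l ≠ a y → a (m l) = l ∧ u l (m l) < u l y := by
        intro l hl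
        obtain ⟨s, hs, hsl⟩ := Finset.mem_image.1 (himg ▸ Finset.mem_univ l)
        rcases Finset.mem_insert.1 hs with rfl | hs
        · exact absurd hsl.symm hl
        have hms : m l = s := by
          refine hu l (le_antisymm (hmin l s hs) ?_)
          have := hamin s (m l) (Finset.mem_insert_of_mem (hmT l))
          rwa [hsl] at this
        refine ⟨by rw [hms, hsl], ?_⟩
        have := hamin s y (Finset.mem_insert_self _ _)
        rw [hsl] at this
        rw [hms]
        refine lt_of_le_of_ne this fun h => hyT ?_
        rwa [← hu l h]
      have hne : a (m (a y)) ≠ a y := by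
        intro h
        have := ha (Finset.mem_insert_of_mem (hmT (a y))) (Finset.mem_insert_self _ _) h
        exact hyT (this ▸ hmT (a y))
      have hk := hcoll (a y) (a (m (a y))) hne
        (ha (Finset.mem_insert_of_mem (hmT _)) (Finset.mem_insert_of_mem (hmT _)) (hma _ hne).1)
      have hyx : y = x (a y) := by
        refine hu (a y) (le_antisymm (hx2 _ y fun l hl => (hma l hl).2) ?_)
        obtain ⟨l, hl⟩ := hy (x (a y))
        by_cases hla : l = a y
        · rw [← hla]
          exact hla ▸ hl y (Finset.mem_insert_self _ _)
        · exact absurd (hx1 _ l hla) (hl _ (Finset.mem_insert_of_mem (hmT l))).not_gt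
      rcases hk with h | h
      · exact Or.inl (h ▸ hyx)
      · exact Or.inr (h ▸ hyx)
    · rintro (rfl | rfl)
      · exact hgood i j hij.symm hmj
      · exact hgood j i hij hmj.symm
  rw [hset, Finset.card_pair hxij]
  exact even_two

/-- A set whose coloring misses some color contains an even number of subsets with one element
fewer on which every color but `i₀` occurs: two if it has such a subset, obtained by removing
either of the two points of equal color, and none otherwise. -/
theorem even_card_subsets_of_not_colorful [Fintype I] [DecidableEq I] [Fintype Z] [DecidableEq Z]
    (c : Z → I) (i₀ : I) {R : Finset Z} (hcard : R.card = Fintype.card I)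
    (hR : R.image c ≠ Finset.univ) :
    Even (Finset.univ.filter fun T : Finset Z =>
      (T.card + 1 = Fintype.card I ∧ T.image c = Finset.univ.erase i₀) ∧ T ⊆ R).card := by
  by_cases hex : ∃ T : Finset Z,
      (T.card + 1 = Fintype.card I ∧ T.image c = Finset.univ.erase i₀) ∧ T ⊆ R
  swap
  · rw [Finset.filter_false_of_mem]
    · simp
    · exact fun T _ hT => hex ⟨T, hT⟩
  obtain ⟨T, ⟨hTc, hTi⟩, hTR⟩ := hex
  have herase : ∀ S : Finset Z, S.card + 1 = Fintype.card I → S ⊆ R → ∃ z ∈ R, S = R.erase z := by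
    intro S hS hSR
    obtain ⟨z, hz, hzS⟩ := Finset.exists_mem_notMem_of_card_lt_card (s := S) (t := R) (by omega)
    refine ⟨z, hz, Finset.eq_of_subset_of_card_le ?_ ?_⟩
    · exact fun t ht => Finset.mem_erase.2 ⟨fun h => hzS (h ▸ ht), hSR ht⟩
    · rw [Finset.card_erase_of_mem hz]; omega
  obtain ⟨x, hxR, rfl⟩ := herase T hTc hTR
  have hinj : Set.InjOn c (R.erase x) := by
    rw [← Finset.card_image_iff, hTi, Finset.card_erase_of_mem (Finset.mem_univ _),
      Finset.card_univ]
    omega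
  have hcx : c x ≠ i₀ := by
    intro h
    apply hR
    rw [← Finset.insert_erase hxR, Finset.image_insert, hTi, h,
      Finset.insert_erase (Finset.mem_univ _)]
  obtain ⟨y, hy, hyx⟩ : ∃ y ∈ R.erase x, c y = c x := by
    rw [← Finset.mem_image, hTi]
    simpa using hcx
  obtain ⟨hyne, hyR⟩ := Finset.mem_erase.1 hy
  have himg : (R.erase y).image c = Finset.univ.erase i₀ := by
    rw [← hTi]
    ext k
    simp only [Finset.mem_image, Finset.mem_erase]
    constructor
    · rintro ⟨t, ⟨-, htR⟩, rfl⟩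
      by_cases htx : t = x
      · exact ⟨y, ⟨hyne, hyR⟩, by rw [hyx, htx]⟩
      · exact ⟨t, ⟨htx, htR⟩, rfl⟩
    · rintro ⟨t, ⟨-, htR⟩, rfl⟩
      by_cases hty : t = y
      · exact ⟨x, ⟨hyne.symm, hxR⟩, by rw [hty, hyx]⟩
      · exact ⟨t, ⟨hty, htR⟩, rfl⟩
  have hset : (Finset.univ.filter fun T : Finset Z =>
      (T.card + 1 = Fintype.card I ∧ T.image c = Finset.univ.erase i₀) ∧ T ⊆ R) =
      {R.erase x, R.erase y} := by
    ext S
    simp only [Finset.mem_filter, Finset.mem_univ, true_and, Finset.mem_insert,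
      Finset.mem_singleton]
    constructor
    · rintro ⟨⟨hSc, hSi⟩, hSR⟩
      obtain ⟨z, hz, rfl⟩ := herase S hSc hSR
      by_cases hzx : z = x
      · exact Or.inl (by rw [hzx])
      · right
        congr 1
        -- the color of `z` still occurs on `R.erase z`, which forces `c z = c x`
        have hcz : c z ∈ (R.erase z).image c := by
          rw [hSi, ← hTi]
          exact Finset.mem_image_of_mem c (Finset.mem_erase.2 ⟨hzx, hz⟩)
        obtain ⟨w, hw, hwz⟩ := Finset.mem_image.1 hcz
        obtain ⟨hwz', hwR⟩ := Finset.mem_erase.1 hw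
        by_cases hwx : w = x
        · refine hinj (Finset.mem_erase.2 ⟨hzx, hz⟩) hy ?_
          rw [hyx, ← hwz, hwx]
        · exact absurd (hinj (Finset.mem_erase.2 ⟨hwx, hwR⟩) (Finset.mem_erase.2 ⟨hzx, hz⟩) hwz)
            hwz'
    · rintro (rfl | rfl)
      · exact ⟨⟨hTc, hTi⟩, Finset.erase_subset _ _⟩
      · refine ⟨⟨?_, himg⟩, Finset.erase_subset _ _⟩
        rw [Finset.card_erase_of_mem hyR, ← hcard]
        have := Finset.card_pos.2 ⟨y, hyR⟩
        omega
  rw [hset, Finset.card_pair]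
  · exact even_two
  · intro h
    have : y ∈ R.erase y := h ▸ hy
    simp at this

/-- **Scarf's lemma.** The points `s k` are slack points: `s k` is the least point for the index
`k`, and lies above every ordinary point for every other index. If each slack point has its own
index as color, then some dominant set carries all the colors. -/
theorem exists_isDominant_colorful [Fintype I] [Nonempty I] [Fintype Z] {u : I → Z → L}
    (hu : ∀ i, Function.Injective (u i)) (s : I → Z)
    (hmin : ∀ k z, u k (s k) ≤ u k z)
    (hbig : ∀ k l x, l ≠ k → x ∉ Set.range s → u l x < u l (s k))
    (hord : ∃ x, x ∉ Set.range s) (c : Z → I) (hc : ∀ k, c (s k) = k) :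
    ∃ R : Finset Z, IsDominant u R ∧ ∀ i, ∃ r ∈ R, c r = i := by
  classical
  obtain ⟨i₀⟩ := ‹Nonempty I›
  have hsinj : Function.Injective s := Function.LeftInverse.injective hc
  have hslt : ∀ k z, z ≠ s k → u k (s k) < u k z := fun k z hz =>
    lt_of_le_of_ne (hmin k z) fun h => hz (hu k h).symm
  by_contra! hcon
  let D : Finset (Finset Z) := Finset.univ.filter fun T =>
    T.card + 1 = Fintype.card I ∧ T.image c = Finset.univ.erase i₀
  let R : Finset (Finset Z) := Finset.univ.filter fun T =>
    T.card = Fintype.card I ∧ IsDominant u T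
  have hRdeg : ∀ S ∈ R, Even (D.filter fun T => T ⊆ S).card := by
    intro S hS
    obtain ⟨hS1, hS2⟩ := (Finset.mem_filter.1 hS).2
    rw [Finset.filter_filter]
    refine even_card_subsets_of_not_colorful c i₀ hS1 fun h => ?_
    obtain ⟨i, hi⟩ := hcon S hS2
    obtain ⟨r, hr, hri⟩ := Finset.mem_image.1 (h ▸ Finset.mem_univ i)
    exact hi r hr hri
  have hdeg : ∀ T ∈ D, (R.filter fun S => T ⊆ S).card =
      (Finset.univ.filter fun x => x ∉ T ∧ IsDominant u (insert x T)).card := by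
    intro T hT
    obtain ⟨hT1, -⟩ := (Finset.mem_filter.1 hT).2
    symm
    refine Finset.card_bij (fun x _ => insert x T) ?_ ?_ ?_
    · intro x hx
      obtain ⟨hxT, hx⟩ := (Finset.mem_filter.1 hx).2
      simp only [R, Finset.mem_filter, Finset.mem_univ, true_and]
      exact ⟨⟨by rw [Finset.card_insert_of_notMem hxT, hT1], hx⟩, Finset.subset_insert _ _⟩
    · intro x hx y hy hxy
      obtain ⟨hxT, -⟩ := (Finset.mem_filter.1 hx).2
      have : x ∈ insert y T := hxy ▸ Finset.mem_insert_self x T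
      exact (Finset.mem_insert.1 this).resolve_right hxT
    · intro S hS
      simp only [R, Finset.mem_filter, Finset.mem_univ, true_and] at hS
      obtain ⟨⟨hS1, hS2⟩, hTS⟩ := hS
      obtain ⟨x, hxS, hxT⟩ := Finset.exists_mem_notMem_of_card_lt_card (s := T) (t := S) (by omega)
      have hins : insert x T = S := by
        refine Finset.eq_of_subset_of_card_le (Finset.insert_subset hxS hTS) ?_
        rw [Finset.card_insert_of_notMem hxT]; omega
      exact ⟨x, by simpa [hxT, hins] using hS2, hins⟩
  let T₀ : Finset Z := (Finset.univ.erase i₀).image s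
  have hT₀ : T₀ ∈ D := by
    simp only [D, T₀, Finset.mem_filter, Finset.mem_univ, true_and]
    rw [Finset.card_image_of_injective _ hsinj, Finset.card_erase_of_mem (Finset.mem_univ _),
      Finset.card_univ, Finset.image_image]
    refine ⟨Nat.sub_add_cancel (Fintype.card_pos_iff.2 ⟨i₀⟩), ?_⟩
    have : c ∘ s = id := funext hc
    rw [this, Finset.image_id]
  have hT₀mem : ∀ l, l ≠ i₀ → s l ∈ T₀ := fun l hl =>
    Finset.mem_image_of_mem s (Finset.mem_erase.2 ⟨hl, Finset.mem_univ _⟩)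
  have hT₀' : ∀ t ∈ T₀, ∃ l, l ≠ i₀ ∧ s l = t := by
    intro t ht
    obtain ⟨l, hl, rfl⟩ := Finset.mem_image.1 ht
    exact ⟨l, (Finset.mem_erase.1 hl).1, rfl⟩
  have hothers : ∀ T ∈ D.erase T₀, Even (R.filter fun S => T ⊆ S).card := by
    intro T hT
    obtain ⟨hne, hT⟩ := Finset.mem_erase.1 hT
    rw [hdeg T hT]
    obtain ⟨hT1, hT2⟩ := (Finset.mem_filter.1 hT).2
    -- `T₀` is the only member of `D` that consists of slack points
    obtain ⟨t, ht, hts⟩ : ∃ t ∈ T, t ∉ Set.range s := by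
      by_contra! hall
      refine hne (Finset.eq_of_subset_of_card_le ?_ ?_)
      · intro t ht
        obtain ⟨k, rfl⟩ := hall t ht
        refine Finset.mem_image_of_mem s ?_
        rw [← hT2]
        exact Finset.mem_image.2 ⟨_, ht, hc k⟩
      · have := (Finset.mem_filter.1 hT₀).2.1
        omega
    exact even_card_dominant_insert hu hT1 ⟨t, ht⟩ fun k =>
      ⟨s k, fun l hl => ⟨t, ht, hbig k l t hl hts⟩⟩
  have hone : (R.filter fun S => T₀ ⊆ S).card = 1 := by
    rw [hdeg T₀ hT₀, Finset.card_eq_one]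
    obtain ⟨x, hx, hxmax⟩ := (Finset.univ.filter fun x => x ∉ Set.range s).exists_max_image (u i₀)
      (by obtain ⟨x, hx⟩ := hord; exact ⟨x, by simpa using hx⟩)
    simp only [Finset.mem_filter, Finset.mem_univ, true_and] at hx hxmax
    refine ⟨x, ?_⟩
    ext y
    simp only [Finset.mem_filter, Finset.mem_univ, true_and, Finset.mem_singleton]
    constructor
    · rintro ⟨hyT, hy⟩
      obtain ⟨i, hi⟩ := hy x
      have hii : i = i₀ := by
        by_contra h
        exact absurd (hslt i x fun h' => hx ⟨i, h'.symm⟩)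
          (hi _ (Finset.mem_insert_of_mem (hT₀mem i h))).not_gt
      subst hii
      have hxy := hi y (Finset.mem_insert_self _ _)
      have hys : y ∉ Set.range s := by
        rintro ⟨k, rfl⟩
        by_cases hk : k = i
        · subst hk
          exact absurd (hslt k x fun h' => hx ⟨k, h'.symm⟩) hxy.not_gt
        · exact hyT (hT₀mem k hk)
      exact hu i (le_antisymm (hxmax y hys) hxy)
    · rintro rfl
      refine ⟨fun h => ?_, fun z => ?_⟩
      · obtain ⟨l, -, hl⟩ := hT₀' y h
        exact hx ⟨l, hl⟩
      · by_cases hz : ∃ l, l ≠ i₀ ∧ s l = z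
        · obtain ⟨l, -, rfl⟩ := hz
          exact ⟨l, fun t _ => hmin l t⟩
        · refine ⟨i₀, fun t ht => ?_⟩
          have hzy : u i₀ z ≤ u i₀ y := by
            by_cases hzs : z ∈ Set.range s
            · obtain ⟨l, rfl⟩ := hzs
              have : l = i₀ := by
                by_contra h
                exact hz ⟨l, h, rfl⟩
              rw [this]
              exact hmin i₀ y
            · exact hxmax z hzs
          rcases Finset.mem_insert.1 ht with rfl | ht
          · exact hzy
          · obtain ⟨l, hl, rfl⟩ := hT₀' t ht
            exact hzy.trans (hbig l i₀ y (Ne.symm hl) hx).le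
  have hsum : ∑ T ∈ D, (R.filter fun S => T ⊆ S).card =
      ∑ S ∈ R, (D.filter fun T => T ⊆ S).card :=
    Finset.sum_card_bipartiteAbove_eq_sum_card_bipartiteBelow _
  have heven : Even (∑ T ∈ D, (R.filter fun S => T ⊆ S).card) :=
    hsum ▸ Finset.even_sum _ hRdeg
  rw [← Finset.add_sum_erase _ _ hT₀, hone] at heven
  have h2 := Finset.even_sum _ hothers
  rw [Nat.even_add] at heven
  exact absurd (heven.2 h2) (by decide)

end Scarf

/-! ### From Scarf's lemma to coverings of the simplex -/

section Covering

variable {I : Type*} [Fintype I]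

/-- Scarf's lemma on the grid of vectors in `I → ℕ` with coordinate sum `m`, ranked by their
coordinates: for every coloring of the grid there is a grid point `q` such that each color `i` with
`q i` large occurs at a grid point near `q`. The bounds do not depend on `m`. -/
theorem exists_grid_point_near_colors [Nonempty I] (m : ℕ) (c : (I → ℕ) → I) :
    ∃ q : I → ℕ, ∑ i, q i = m ∧ ∀ i, q i ≤ Fintype.card I ∨
      ∃ x : I → ℕ, ∑ j, x j = m ∧ c x = i ∧
        ∀ j, x j ≤ q j + Fintype.card I ∧ q j ≤ x j + Fintype.card I := by
  classical
  let X := {x : I → ℕ // x ∈ Finset.piAntidiag Finset.univ m}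
  have hX : ∀ x : X, ∑ i, x.1 i = m := fun x => (Finset.mem_piAntidiag.1 x.2).1
  have : Fintype X := Finset.fintypeCoeSort (Finset.piAntidiag Finset.univ m)
  have hXle : ∀ (x : X) i, x.1 i ≤ m := fun x i => by
    have := Finset.single_le_sum (f := x.1) (fun _ _ => Nat.zero_le _) (Finset.mem_univ i)
    rwa [hX x] at this
  let p : X ⊕ I → I → ℤ :=
    Sum.elim (fun x i => (x.1 i : ℤ)) (fun k i => if i = k then -1 else m + 1)
  let e := Fintype.equivFin (X ⊕ I)
  -- the second component only breaks ties
  let u : I → X ⊕ I → Lex (ℤ × Fin (Fintype.card (X ⊕ I))) := fun i z => toLex (p z i, e z)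
  have hu : ∀ i, Function.Injective (u i) := by
    intro i z z' h
    have : (p z i, e z) = (p z' i, e z') := h
    exact e.injective (Prod.ext_iff.1 this).2
  have hlt : ∀ i z z', p z i < p z' i → u i z < u i z' := fun i z z' h =>
    Prod.Lex.toLex_lt_toLex.2 (Or.inl h)
  have hle : ∀ i z z', u i z ≤ u i z' → p z i ≤ p z' i := fun i z z' h => by
    by_contra hcon
    exact absurd (hlt i _ _ (not_le.1 hcon)) h.not_gt
  obtain ⟨R, hR, hcol⟩ := exists_isDominant_colorful hu (Sum.inr : I → X ⊕ I)
    (by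
      intro k z
      by_cases hz : z = Sum.inr k
      · rw [hz]
      · refine (hlt k _ _ ?_).le
        rcases z with x | l
        · simp only [p, Sum.elim_inl, Sum.elim_inr, if_true]
          omega
        · have hkl : k ≠ l := fun h => hz (by rw [h])
          simp only [p, Sum.elim_inr, if_true, if_neg hkl]
          omega)
    (by
      intro k l z hlk hz
      refine hlt l _ _ ?_
      rcases z with x | j
      · simp only [p, Sum.elim_inl, Sum.elim_inr, if_neg hlk]
        have := hXle x l
        omega
      · exact absurd ⟨j, rfl⟩ hz)
    (by
      obtain ⟨i⟩ := ‹Nonempty I›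
      exact ⟨Sum.inl ⟨Pi.single i m, by simp⟩, by simp⟩)
    (Sum.elim (fun x => c x.1) id) (fun k => rfl)
  have hdom : ∀ z, ∃ i, ∀ t ∈ R, p z i ≤ p t i := fun z =>
    (hR z).imp fun i hi t ht => hle i z t (hi t ht)
  have hdomX : ∀ x : I → ℕ, ∑ i, x i = m →
      ∃ i, Sum.inr i ∉ R ∧ ∀ y : X, Sum.inl y ∈ R → x i ≤ y.1 i := by
    intro x hx
    obtain ⟨i, hi⟩ := hdom (Sum.inl ⟨x, by simpa using hx⟩)
    refine ⟨i, fun h => ?_, fun y hy => ?_⟩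
    · have := hi _ h
      simp only [p, Sum.elim_inl, Sum.elim_inr, if_true] at this
      omega
    · have := hi _ hy
      simpa [p] using this
  have hcolX : ∀ i, Sum.inr i ∉ R → ∃ x : X, Sum.inl x ∈ R ∧ c x.1 = i := by
    intro i hi
    obtain ⟨r, hr, hri⟩ := hcol i
    rcases r with x | k
    · exact ⟨x, hr, hri⟩
    · have : k = i := hri
      exact absurd (this ▸ hr) hi
  obtain ⟨q, hq⟩ : ∃ q : X, Sum.inl q ∈ R := by
    obtain ⟨i⟩ := ‹Nonempty I›
    obtain ⟨k, hk, -⟩ := hdomX (Pi.single i m) (by simp)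
    obtain ⟨x, hx, -⟩ := hcolX k hk
    exact ⟨x, hx⟩
  choose y hyR hy using fun i => (Finset.univ.filter fun x : X => Sum.inl x ∈ R).exists_min_image
    (fun x => x.1 i) ⟨q, by simpa using hq⟩
  simp only [Finset.mem_filter, Finset.mem_univ, true_and] at hyR hy
  -- `w` is a common lower bound of the grid points of `R`, of almost full coordinate sum
  let w : I → ℕ := fun i => if Sum.inr i ∈ R then 0 else (y i).1 i
  have hwle : ∀ x : X, Sum.inl x ∈ R → ∀ i, w i ≤ x.1 i := by
    intro x hx i
    simp only [w]
    split_ifs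
    · exact Nat.zero_le _
    · exact hy i x hx
  have hw : m ≤ ∑ i, w i + Fintype.card I := by
    by_contra! hlt
    have hsum : ∑ i, (w i + 1) = ∑ i, w i + Fintype.card I := by
      simp [Finset.sum_add_distrib]
    obtain ⟨i₀⟩ := ‹Nonempty I›
    obtain ⟨i, hi, hle⟩ := hdomX
      (fun i => (w i + 1) + Pi.single (M := fun _ => ℕ) i₀ (m - ∑ i, (w i + 1)) i) (by
        rw [Finset.sum_add_distrib, Finset.sum_pi_single']
        simp only [Finset.mem_univ, if_true]
        omega)
    have := hle (y i) (hyR i)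
    simp only [w, if_neg hi] at this
    omega
  have hnear : ∀ x : X, Sum.inl x ∈ R → ∀ i, x.1 i ≤ w i + Fintype.card I := by
    intro x hx i
    have h1 : ∑ j ∈ Finset.univ.erase i, w j ≤ ∑ j ∈ Finset.univ.erase i, x.1 j :=
      Finset.sum_le_sum fun j _ => hwle x hx j
    have h2 := Finset.add_sum_erase Finset.univ w (Finset.mem_univ i)
    have h3 := Finset.add_sum_erase Finset.univ x.1 (Finset.mem_univ i)
    rw [hX x] at h3
    omega
  refine ⟨q.1, hX q, fun i => ?_⟩
  by_cases hi : Sum.inr i ∈ R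
  · left
    have := hnear q hq i
    simpa [w, hi] using this
  · right
    obtain ⟨x, hx, hxi⟩ := hcolX i hi
    exact ⟨x.1, hX x, hxi, fun j =>
      ⟨(hnear x hx j).trans (Nat.add_le_add_right (hwle q hq j) _),
        (hnear q hq j).trans (Nat.add_le_add_right (hwle x hx j) _)⟩⟩

/-- The grid statement rescaled by `m` to the standard simplex. -/
theorem exists_mem_stdSimplex_near_cover [Nonempty I] {A : I → Set (I → ℝ)}
    (hcov : stdSimplex ℝ I ⊆ ⋃ i, A i) {m : ℕ} (hm : 0 < m) :
    ∃ q ∈ stdSimplex ℝ I, ∀ i, q i ≤ Fintype.card I / (m : ℝ) ∨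
      ∃ x ∈ A i, dist x q ≤ Fintype.card I / (m : ℝ) := by
  have hm' : (0 : ℝ) < m := Nat.cast_pos.2 hm
  have hmem : ∀ x : I → ℕ, ∑ i, x i = m → (fun i => (x i : ℝ) / m) ∈ stdSimplex ℝ I := by
    intro x hx
    refine ⟨fun i => by positivity, ?_⟩
    rw [← Finset.sum_div, ← Nat.cast_sum, hx, div_self hm'.ne']
  have hcolor : ∀ x : I → ℕ, ∃ i, ∑ i, x i = m → (fun i => (x i : ℝ) / m) ∈ A i := by
    intro x
    by_cases hx : ∑ i, x i = m
    · obtain ⟨i, hi⟩ := Set.mem_iUnion.1 (hcov (hmem x hx))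
      exact ⟨i, fun _ => hi⟩
    · exact ⟨Classical.arbitrary I, fun h => absurd h hx⟩
  choose c hc using hcolor
  obtain ⟨q, hq, hqc⟩ := exists_grid_point_near_colors m c
  refine ⟨_, hmem q hq, fun i => (hqc i).imp (fun h => ?_) ?_⟩
  · have : (q i : ℝ) ≤ Fintype.card I := by exact_mod_cast h
    gcongr
  · rintro ⟨x, hx, rfl, hxq⟩
    refine ⟨_, hc x hx, (dist_pi_le_iff (by positivity)).2 fun j => ?_⟩
    have h1 : (x j : ℝ) ≤ q j + Fintype.card I := by exact_mod_cast (hxq j).1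
    have h2 : (q j : ℝ) ≤ x j + Fintype.card I := by exact_mod_cast (hxq j).2
    rw [Real.dist_eq, ← sub_div, abs_div, abs_of_pos hm']
    gcongr
    rw [abs_le]
    constructor <;> linarith

/-- If closed sets `A i` cover the standard simplex, then some point of the simplex lies in `A i`
for every `i` in its support. -/
theorem exists_mem_stdSimplex_forall_eq_zero_or_mem [Nonempty I] {A : I → Set (I → ℝ)}
    (hA : ∀ i, IsClosed (A i)) (hcov : stdSimplex ℝ I ⊆ ⋃ i, A i) :
    ∃ p ∈ stdSimplex ℝ I, ∀ i, p i = 0 ∨ p ∈ A i := by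
  choose q hq hqA using fun k : ℕ => exists_mem_stdSimplex_near_cover hcov k.succ_pos
  obtain ⟨p, hp, φ, hφ, hlim⟩ := (isCompact_stdSimplex ℝ I).tendsto_subseq hq
  have hε : Filter.Tendsto (fun k : ℕ => (Fintype.card I : ℝ) / ((φ k).succ : ℕ)) Filter.atTop
      (nhds 0) :=
    (tendsto_const_div_atTop_nhds_zero_nat (Fintype.card I : ℝ)).comp
      ((Filter.tendsto_add_atTop_nat 1).comp hφ.tendsto_atTop)
  refine ⟨p, hp, fun i => or_iff_not_imp_left.2 fun hpi => ?_⟩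
  have hpi' : 0 < p i := lt_of_le_of_ne (hp.1 i) (Ne.symm hpi)
  have hlimi : Filter.Tendsto (fun k => q (φ k) i) Filter.atTop (nhds (p i)) :=
    tendsto_pi_nhds.1 hlim i
  rw [← (hA i).closure_eq, Metric.mem_closure_iff]
  intro ε hε0
  obtain ⟨k, hk1, hk2, hk3⟩ := ((hε.eventually_lt hlimi hpi').and
    ((hε.eventually_lt_const (half_pos hε0)).and
      (Metric.tendsto_nhds.1 hlim _ (half_pos hε0)))).exists
  obtain ⟨x, hx, hxq⟩ := (hqA (φ k) i).resolve_left hk1.not_ge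
  refine ⟨x, hx, ?_⟩
  have := dist_triangle_left p x (q (φ k))
  rw [dist_comm x] at hxq
  simp only [Function.comp_apply] at hk3
  linarith

/-- The **Knaster–Kuratowski–Mazurkiewicz lemma**: closed sets `G i` such that every point of the
standard simplex lies in some `G i` with `i` in its support have a common point in the simplex. -/
theorem exists_mem_stdSimplex_forall_mem [Nonempty I] {G : I → Set (I → ℝ)}
    (hG : ∀ i, IsClosed (G i)) (hcov : ∀ x ∈ stdSimplex ℝ I, ∃ i, 0 < x i ∧ x ∈ G i) :
    ∃ p ∈ stdSimplex ℝ I, ∀ i, p ∈ G i := by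
  classical
  have hne : ∀ i, (G i).Nonempty := by
    intro i
    obtain ⟨j, hj, hjG⟩ := hcov _ (single_mem_stdSimplex ℝ i)
    have : j = i := by
      by_contra h
      simp [Pi.single_eq_of_ne h] at hj
    exact ⟨_, this ▸ hjG⟩
  let g : I → (I → ℝ) → ℝ := fun i x => Metric.infDist x (G i)
  have hgc : ∀ i, Continuous (g i) := fun i => Metric.continuous_infDist_pt _
  have hg0 : ∀ i x, 0 ≤ g i x := fun i x => Metric.infDist_nonneg
  have hg : ∀ i x, x ∈ G i ↔ g i x = 0 := fun i x => (hG i).mem_iff_infDist_zero (hne i)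
  obtain ⟨p, hp, hpA⟩ := exists_mem_stdSimplex_forall_eq_zero_or_mem
    (A := fun i => {x | x i * ∑ j, g j x ≤ g i x})
    (fun i => isClosed_le ((continuous_apply i).mul (continuous_finsetSum _ fun j _ => hgc j))
      (hgc i))
    (by
      intro x hx
      by_contra hcon
      simp only [Set.mem_iUnion, Set.mem_ofPred_eq, not_exists, not_le] at hcon
      have := Finset.sum_lt_sum_of_nonempty Finset.univ_nonempty fun i _ => hcon i
      rw [← Finset.sum_mul, hx.2, one_mul] at this
      exact lt_irrefl _ this)
  refine ⟨p, hp, fun k => (hg k p).2 ?_⟩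
  -- an index in the support of `p` with `p ∈ G i` forces all the distances to vanish
  obtain ⟨i, hi, hiG⟩ := hcov p hp
  have h1 : p i * ∑ j, g j p ≤ g i p := (hpA i).resolve_left hi.ne'
  rw [(hg i p).1 hiG] at h1
  have h2 : ∑ j, g j p ≤ 0 := by
    by_contra! h
    exact absurd (mul_pos hi h) h1.not_gt
  exact le_antisymm
    ((Finset.single_le_sum (fun j _ => hg0 j p) (Finset.mem_univ k)).trans h2) (hg0 k p)

/-- The finite form of Fan's lemma: the Knaster–Kuratowski–Mazurkiewicz lemma for the simplex
spanned by finitely many, possibly affinely dependent, points of a topological vector space. -/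
theorem exists_mem_convexHull_forall_mem [Nonempty I] {X : Type*} [AddCommGroup X] [Module ℝ X]
    [TopologicalSpace X] [IsTopologicalAddGroup X] [ContinuousSMul ℝ X] (x : I → X)
    {G : I → Set X} (hG : ∀ i, IsClosed (G i))
    (hcov : ∀ w ∈ stdSimplex ℝ I, ∃ i, 0 < w i ∧ ∑ j, w j • x j ∈ G i) :
    ∃ y ∈ convexHull ℝ (Set.range x), ∀ i, y ∈ G i := by
  have hcont : Continuous fun w : I → ℝ => ∑ j, w j • x j :=
    continuous_finsetSum _ fun j _ => (continuous_apply j).smul continuous_const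
  obtain ⟨p, hp, hpG⟩ := exists_mem_stdSimplex_forall_mem
    (G := fun i => (fun w : I → ℝ => ∑ j, w j • x j) ⁻¹' G i)
    (fun i => (hG i).preimage hcont) hcov
  refine ⟨_, ?_, hpG⟩
  exact (convex_convexHull ℝ _).sum_mem (fun i _ => hp.1 i) hp.2
    fun i _ => subset_convexHull ℝ _ ⟨i, rfl⟩

end Covering

/-! ### The fixed point theorem -/

theorem theorem1 {X : Type*} [AddCommGroup X] [Module ℝ X] [MetricSpace X]
    [IsTopologicalAddGroup X] [ContinuousSMul ℝ X]
    (C : Set X) (hne : C.Nonempty) (hclosed : IsClosed C) (hconv : Convex ℝ C)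
    (f : C → C)
    (ha : Function.Surjective f)
    (hb : ∀ (s : Finset C) (hs : s.Nonempty) (α : C → ℝ) (u : X),
      (∀ x ∈ s, 0 < α x) → ∑ x ∈ s, α x = 1 → u = ∑ x ∈ s, α x • (x : X) →
      0 ≤ s.sup' hs (fun x => dist (f x : X) u - dist (x : X) u))
    (hc : ∃ xstar : C, IsCompact {y : X | y ∈ C ∧ dist (xstar : X) y ≤ dist (f xstar : X) y}) :
    ∃ x : C, f x = x := by
  classical
  obtain ⟨a, hcomp⟩ := hc
  let G : C → Set X := fun x => {y | y ∈ C ∧ dist (x : X) y ≤ dist (f x : X) y}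
  have hGclosed : ∀ x, IsClosed (G x) := fun x =>
    hclosed.inter (isClosed_le (continuous_const.dist continuous_id)
      (continuous_const.dist continuous_id))
  have hfin : ∀ s : Finset C, s.Nonempty → ∃ y, ∀ x ∈ s, y ∈ G x := by
    intro s hs
    have : Nonempty s := hs.to_subtype
    obtain ⟨y, -, hy⟩ := exists_mem_convexHull_forall_mem (I := s) (fun x => ((x : C) : X))
      (G := fun x => G x) (fun x => hGclosed x) (by
        intro w hw
        let t : Finset s := Finset.univ.filter fun x => 0 < w x
        have hzero : ∀ x : s, x ∉ t → w x = 0 := fun x hx =>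
          le_antisymm (not_lt.1 fun h => hx (by simpa [t] using h)) (hw.1 x)
        have hsum : ∑ x ∈ t, w x = 1 := by
          rw [← hw.2]
          exact Finset.sum_subset (Finset.subset_univ _) fun x _ hx => hzero x hx
        have hsum' : ∑ x ∈ t, w x • ((x : C) : X) = ∑ x, w x • ((x : C) : X) :=
          Finset.sum_subset (Finset.subset_univ _) fun x _ hx => by rw [hzero x hx, zero_smul]
        have ht : t.Nonempty := by
          by_contra h
          rw [Finset.not_nonempty_iff_eq_empty.1 h] at hsum
          simp at hsum
        let α : C → ℝ := fun x => if h : x ∈ s then w ⟨x, h⟩ else 0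
        have hα : ∀ x : s, α x = w x := fun x => by simp [α]
        have hmax := hb (t.map (Function.Embedding.subtype _)) (ht.map)
          α (∑ x, w x • ((x : C) : X))
          (by
            intro x hx
            obtain ⟨z, hz, rfl⟩ := Finset.mem_map.1 hx
            simpa [hα, t] using hz)
          (by simpa [Finset.sum_map, hα] using hsum)
          (by simpa [Finset.sum_map, hα] using hsum'.symm)
        obtain ⟨x, hx, hxmax⟩ := (Finset.le_sup'_iff _).1 hmax
        obtain ⟨z, hz, rfl⟩ := Finset.mem_map.1 hx
        exact ⟨z, by simpa [t] using hz,
          hconv.sum_mem (fun j _ => hw.1 j) hw.2 fun j _ => j.1.2, sub_nonneg.1 hxmax⟩)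
    exact ⟨y, fun x hx => hy ⟨x, hx⟩⟩
  obtain ⟨y, -, hy⟩ := hcomp.inter_iInter_nonempty G hGclosed (by
    intro s
    obtain ⟨y, hy⟩ := hfin (insert a s) (Finset.insert_nonempty _ _)
    exact ⟨y, hy a (Finset.mem_insert_self _ _),
      Set.mem_iInter₂.2 fun x hx => hy x (Finset.mem_insert_of_mem hx)⟩)
  rw [Set.mem_iInter] at hy
  -- at a preimage `x` of `y` the inequality defining `G x` reads `dist x y ≤ dist y y = 0`
  obtain ⟨x, hx⟩ := ha ⟨y, (hy a).1⟩
  refine ⟨x, ?_⟩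
  have h := (hy x).2
  rw [hx, dist_self] at h
  rw [hx]
  exact Subtype.ext (dist_le_zero.1 h).symm
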